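/- Let $n\ge 1$ and let $\sigma\in\mathfrak S_n$ be an $n$-cycle, that is, a permutation of $\{1,\dots,n\}$ that acts transitively (for $n=1$ this is the identity). Let $\ell_S(\sigma)$ be the length of $\sigma$ (the minimal number of adjacent transpositions whose product is $\sigma$), let $\ell_T(\sigma)$ be its reflection length (the minimal number of conjugates of adjacent transpositions, i.e. of arbitrary transpositions, whose product is $\sigma$), and let $\operatorname{depth}(\sigma)=\sum_{\sigma(i)>i}(\sigma(i)-i)$. A permutation is called shallow if $\operatorname{depth}(\sigma)=(\ell_S(\sigma)+\ell_T(\sigma))/2$. Let $\Phi(\sigma)$ be the image of $\sigma$ under the fundamental bijection: write every cycle of $\sigma$ (including fixed points) as $(a\ \sigma(a)\ \sigma^2(a)\ \cdots)$ with its largest element $a$ first, arrange the cycles from left to right in increasing order of their largest elements, erase the parentheses, and read the resulting word as the one-line notation of $\Phi(\sigma)$. For a vincular pattern $p$, i.e. a permutation some of whose consecutive letters are bonded (letters under a common underline are bonded to one another), let $[p](\tau)$ be the number of subsequences of the one-line notation of $\tau$ that are in the same relative order as $p$ and in which bonded letters occupy consecutive positions of $\tau$; $\tau$ avoids $p$ if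 there is no such subsequence. Then \begin{align*} \ell_S(\sigma) &= n-1+2\left([\underline{2}\,\underline{31}]+[\underline{14}\,\underline{23}]+[\underline{41}\,\underline{32}]\right)(\Phi(\sigma)),\\ \operatorname{depth}(\sigma) &= n-1+\left([\underline{2}\,\underline{31}]+[\underline{14}\,\underline{23}]+[\underline{41}\,\underline{32}]+[\underline{24}\,\underline{13}]+[\underline{31}\,\underline{42}]\right)(\Phi(\sigma))\\ &= \frac{\ell_S(\sigma)+\ell_T(\sigma)}{2}+\left([\underline{31}\,\underline{42}]+[\underline{24}\,\underline{13}]\right)(\Phi(\sigma)). \end{align*} In particular, $\sigma$ is shallow if and only if $\Phi(\sigma)$ avoids both $\underline{31}\,\underline{42}$ and $\underline{24}\,\underline{13}$. -/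

import Mathlib

/-!
Permutations of `[1, n]` are modelled as `Equiv.Perm (Fin n)`, so all positions and values are
shifted down by one. The one-line notation of `σ` is the word `σ 0, σ 1, …, σ (n - 1)`.
-/

namespace PermStat

/-- The minimal number of elements of `A` whose product is `g`. -/
noncomputable def wordLength {G : Type*} [Group G] (A : Set G) (g : G) : ℕ :=
  sInf {k : ℕ | ∃ l : List G, l.length = k ∧ (∀ a ∈ l, a ∈ A) ∧ l.prod = g}

/-- The simple reflections: the adjacent transpositions. -/
def simpleReflections (n : ℕ) : Set (Equiv.Perm (Fin n)) :=
  {s | ∃ i j : Fin n, (j : ℕ) = (i : ℕ) + 1 ∧ s = Equiv.swap i j}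

/-- The reflections: the conjugates of the simple reflections. -/
def reflections (n : ℕ) : Set (Equiv.Perm (Fin n)) :=
  {t | ∃ s ∈ simpleReflections n, IsConj s t}

/-- The length `ℓ_S`. -/
noncomputable def length {n : ℕ} (σ : Equiv.Perm (Fin n)) : ℕ :=
  wordLength (simpleReflections n) σ

/-- The reflection length `ℓ_T`. -/
noncomputable def reflectionLength {n : ℕ} (σ : Equiv.Perm (Fin n)) : ℕ :=
  wordLength (reflections n) σ

/-- The depth of `σ`: the sum of `σ i - i` over all `i` with `σ i > i`
(so the subtraction of natural numbers never truncates). -/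
def depth {n : ℕ} (σ : Equiv.Perm (Fin n)) : ℕ :=
  ∑ i : Fin n with i < σ i, ((σ i : ℕ) - (i : ℕ))

/-- A permutation is shallow if its depth is `(ℓ_S + ℓ_T) / 2`. -/
def IsShallow {n : ℕ} (σ : Equiv.Perm (Fin n)) : Prop :=
  (depth σ : ℚ) = ((length σ : ℚ) + (reflectionLength σ : ℚ)) / 2

/-! ### The fundamental bijection -/

/-- The cycle of `σ` through `a`, written `a, σ a, σ² a, …`; a fixed point gives the one-letter
word `a`. -/
def cycleWord {n : ℕ} (σ : Equiv.Perm (Fin n)) (a : Fin n) : List (Fin n) :=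
  if σ a = a then [a] else σ.toList a

/-- `a` is the largest element of its cycle. -/
def IsCycleMax {n : ℕ} (σ : Equiv.Perm (Fin n)) (a : Fin n) : Prop :=
  ∀ b : Fin n, σ.SameCycle a b → b ≤ a

instance {n : ℕ} (σ : Equiv.Perm (Fin n)) (a : Fin n) : Decidable (IsCycleMax σ a) :=
  inferInstanceAs (Decidable (∀ b : Fin n, σ.SameCycle a b → b ≤ a))

/-- The standard representation of `σ` with the cycle demarcations erased: each cycle is written
with its largest element first, and the cycles are written in increasing order of their largest
elements. -/
def fundamentalWord {n : ℕ} (σ : Equiv.Perm (Fin n)) : List (Fin n) :=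
  (List.finRange n).flatMap fun a => if IsCycleMax σ a then cycleWord σ a else []

theorem mem_cycleWord {n : ℕ} (σ : Equiv.Perm (Fin n)) (a b : Fin n) :
    b ∈ cycleWord σ a ↔ σ.SameCycle a b := by
  unfold cycleWord
  split_ifs with h
  · rw [List.mem_singleton]
    constructor
    · rintro rfl
      exact Equiv.Perm.SameCycle.refl _ _
    · intro hs
      exact (Equiv.Perm.SameCycle.eq_of_left hs h).symm
  · rw [Equiv.Perm.mem_toList_iff, Equiv.Perm.mem_support]
    exact ⟨fun hb => hb.1, fun hb => ⟨hb, h⟩⟩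

theorem mem_fundamentalWord {n : ℕ} (σ : Equiv.Perm (Fin n)) (b : Fin n) :
    b ∈ fundamentalWord σ := by
  classical
  have hne : (Finset.univ.filter fun c => σ.SameCycle b c).Nonempty :=
    ⟨b, by simp [Equiv.Perm.SameCycle.refl]⟩
  obtain ⟨a, ha, hmax⟩ := Finset.exists_max_image _ id hne
  have hba : σ.SameCycle b a := by simpa using ha
  refine List.mem_flatMap.2 ⟨a, List.mem_finRange a, ?_⟩
  have hm : IsCycleMax σ a := fun c hc => hmax c (by simpa using hba.trans hc)
  rw [if_pos hm, mem_cycleWord]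
  exact hba.symm

theorem nodup_fundamentalWord {n : ℕ} (σ : Equiv.Perm (Fin n)) : (fundamentalWord σ).Nodup := by
  refine List.nodup_flatMap.2 ⟨fun a _ => ?_, (List.nodup_finRange n).imp ?_⟩
  · split_ifs
    · unfold cycleWord
      split_ifs
      · exact List.nodup_singleton a
      · exact Equiv.Perm.nodup_toList σ a
    · exact List.nodup_nil
  · intro a b hab c hca hcb
    dsimp only at hca hcb
    split_ifs at hca with ha
    · split_ifs at hcb with hb
      · rw [mem_cycleWord] at hca hcb
        have h := hca.trans hcb.symm
        exact hab (le_antisymm (hb a h.symm) (ha b h))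
      · simp at hcb
    · simp at hca

theorem length_fundamentalWord {n : ℕ} (σ : Equiv.Perm (Fin n)) :
    (fundamentalWord σ).length = n := by
  have h := Fintype.card_congr (List.Nodup.getEquivOfForallMemList (fundamentalWord σ)
    (nodup_fundamentalWord σ) (mem_fundamentalWord σ))
  simpa using h

/-- The fundamental bijection: `fundamental σ` is the permutation whose one-line notation is
`fundamentalWord σ`. -/
def fundamental {n : ℕ} (σ : Equiv.Perm (Fin n)) : Equiv.Perm (Fin n) :=
  (finCongr (length_fundamentalWord σ).symm).trans
    (List.Nodup.getEquivOfForallMemList (fundamentalWord σ)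
      (nodup_fundamentalWord σ) (mem_fundamentalWord σ))

/-! ### Vincular patterns -/

/-- A vincular pattern with `k` letters: a permutation, some of whose consecutive letters are
bonded together. `i ∈ bonds` means that the letters in positions `i` and `i + 1` are bonded. -/
structure VincularPattern (k : ℕ) where
  perm : Equiv.Perm (Fin k)
  bonds : Finset (Fin k)

/-- The subsequence `τ (e 0), τ (e 1), …, τ (e (k - 1))` of the one-line notation of `τ` is an
occurrence of `p`: it is in the same relative order as `p`, and bonded letters are consecutive
in `τ`. -/
def IsOccurrence {k n : ℕ} (p : VincularPattern k) (τ : Equiv.Perm (Fin n))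
    (e : Fin k → Fin n) : Prop :=
  (∀ i j : Fin k, i < j → e i < e j) ∧
  (∀ i j : Fin k, τ (e i) ≤ τ (e j) ↔ p.perm i ≤ p.perm j) ∧
  (∀ i j : Fin k, i ∈ p.bonds → (j : ℕ) = (i : ℕ) + 1 → (e j : ℕ) = (e i : ℕ) + 1)

instance {k n : ℕ} (p : VincularPattern k) (τ : Equiv.Perm (Fin n)) :
    DecidablePred (IsOccurrence p τ) := fun e => by
  unfold IsOccurrence
  infer_instance

/-- The number of occurrences of `p` in `τ`. -/
def patternCount {k n : ℕ} (p : VincularPattern k) (τ : Equiv.Perm (Fin n)) : ℕ :=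
  (Finset.univ.filter fun e : Fin k → Fin n => IsOccurrence p τ e).card

/-- `τ` avoids `p`. -/
def Avoids {k n : ℕ} (τ : Equiv.Perm (Fin n)) (p : VincularPattern k) : Prop :=
  ¬ ∃ e : Fin k → Fin n, IsOccurrence p τ e

/-! In the following patterns, the first vector is the one-line notation with every letter
lowered by one, and the second one is that of the inverse permutation. -/

/-- The pattern `231` with `31` bonded. -/
def pat2_31 : VincularPattern 3 :=
  ⟨⟨![1, 2, 0], ![2, 0, 1], by decide, by decide⟩, {1}⟩

/-- The pattern `1423` with `14` and `23` bonded. -/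
def pat14_23 : VincularPattern 4 :=
  ⟨⟨![0, 3, 1, 2], ![0, 2, 3, 1], by decide, by decide⟩, {0, 2}⟩

/-- The pattern `4132` with `41` and `32` bonded. -/
def pat41_32 : VincularPattern 4 :=
  ⟨⟨![3, 0, 2, 1], ![1, 3, 2, 0], by decide, by decide⟩, {0, 2}⟩

/-- The pattern `2413` with `24` and `13` bonded. -/
def pat24_13 : VincularPattern 4 :=
  ⟨⟨![1, 3, 0, 2], ![2, 0, 3, 1], by decide, by decide⟩, {0, 2}⟩

/-- The pattern `3142` with `31` and `42` bonded. -/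
def pat31_42 : VincularPattern 4 :=
  ⟨⟨![2, 0, 3, 1], ![1, 3, 0, 2], by decide, by decide⟩, {0, 2}⟩

end PermStat

namespace PermStat

/-! Write Φ(σ) = w_0 w_1 … w_{n-1}. For an n-cycle this word is the orbit of the largest point, so
after closing it up with w_n = w_0 its arcs w_i → w_{i+1} are exactly the pairs x → σ(x). The
statistics become counts of pairs of arcs, or of an arc and a letter. The engine is telescoping:
along a stretch of the word, upward minus downward crossings of a level depend only on the two ends,
and w_0 is the maximum.

Length is the inversion number, an inversion being two arcs whose sources and targets are oppositely
ordered. Telescoping over the arcs before arc j (`IsMaxWord.sum_inversions`) gives twice the nested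
patterns 14-23 and 41-32, plus the earlier letters strictly between the ends of arc j, plus one if
arc j rises. Telescoping after each letter (`IsMaxWord.pairCount_ascents`) trades letters under
later rising arcs, together with the ascents, for letters under later falling arcs (the pattern
2-31) and n - 1.

Depth is also the total drop of the falling arcs, hence a count of letters under them. Letters
preceding the arc give 2-31; each of the n - 1 letters other than w_0 lies under 1 plus a number of
earlier arcs given by the four bonded patterns (`IsMaxWord.sum_descents_over`).

The reflection length is n - 1, since a transitive product of transpositions must connect n points.
The comparison of depth with length is then algebra. -/

theorem wordLength_le {G : Type*} [Group G] {A : Set G} {g : G} (l : List G)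
    (hl : ∀ a ∈ l, a ∈ A) (hg : l.prod = g) : wordLength A g ≤ l.length :=
  Nat.sInf_le ⟨l, rfl, hl, hg⟩

theorem exists_word_length_eq {G : Type*} [Group G] {A : Set G} {g : G} (l : List G)
    (hl : ∀ a ∈ l, a ∈ A) (hg : l.prod = g) :
    ∃ l' : List G, l'.length = wordLength A g ∧ (∀ a ∈ l', a ∈ A) ∧ l'.prod = g :=
  Nat.sInf_mem (s := {k : ℕ | ∃ l : List G, l.length = k ∧ (∀ a ∈ l, a ∈ A) ∧ l.prod = g})
    ⟨l.length, l, rfl, hl, hg⟩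

/-! ### The length is the number of inversions -/

/-- The inversions of `σ`, as pairs of positions. -/
def inversions {n : ℕ} (σ : Equiv.Perm (Fin n)) : Finset (Fin n × Fin n) :=
  Finset.univ.filter fun p => p.1 < p.2 ∧ σ p.2 < σ p.1

theorem mem_inversions {n : ℕ} (σ : Equiv.Perm (Fin n)) (i j : Fin n) :
    (i, j) ∈ inversions σ ↔ i < j ∧ σ j < σ i := by
  simp [inversions]

theorem swap_adjacent_lt {n : ℕ} {a b x y : Fin n} (hab : (b : ℕ) = a + 1)
    (h : Equiv.swap a b x < Equiv.swap a b y) : x < y ∨ (y = a ∧ x = b) := by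
  simp only [Equiv.swap_apply_def] at h
  split_ifs at h <;> simp only [Fin.lt_def, Fin.ext_iff] at * <;> omega

/-- No value lies between `a` and `b`, so exchanging them alters the relative order of that one pair
only. -/
theorem inversions_swap_mul_subset {n : ℕ} {a b : Fin n} (hab : (b : ℕ) = a + 1)
    (σ : Equiv.Perm (Fin n)) :
    inversions (Equiv.swap a b * σ) ⊆ insert (σ.symm a, σ.symm b) (inversions σ) := by
  rintro ⟨i, j⟩ h
  rw [mem_inversions, Equiv.Perm.mul_apply, Equiv.Perm.mul_apply] at h
  rw [Finset.mem_insert, mem_inversions, Prod.mk.injEq, Equiv.eq_symm_apply, Equiv.eq_symm_apply]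
  rcases swap_adjacent_lt hab h.2 with h' | h'
  · exact Or.inr ⟨h.1, h'⟩
  · exact Or.inl h'

theorem card_inversions_prod_le {n : ℕ} (l : List (Equiv.Perm (Fin n)))
    (hl : ∀ s ∈ l, s ∈ simpleReflections n) : (inversions l.prod).card ≤ l.length := by
  induction l with
  | nil =>
    rw [List.prod_nil, List.length_nil, Nat.le_zero, Finset.card_eq_zero,
      Finset.eq_empty_iff_forall_notMem]
    rintro ⟨i, j⟩ h
    rw [mem_inversions] at h
    exact lt_asymm h.1 h.2
  | cons s l ih =>
    obtain ⟨a, b, hab, rfl⟩ := hl s List.mem_cons_self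
    rw [List.prod_cons, List.length_cons]
    refine (Finset.card_le_card (inversions_swap_mul_subset hab l.prod)).trans ?_
    refine (Finset.card_insert_le _ _).trans ?_
    exact Nat.succ_le_succ (ih fun s hs => hl s (List.mem_cons_of_mem _ hs))

theorem inversions_swap_mul_ssubset {n : ℕ} {a b : Fin n} (hab : (b : ℕ) = a + 1)
    {σ : Equiv.Perm (Fin n)} (h : σ.symm b < σ.symm a) :
    inversions (Equiv.swap a b * σ) ⊂ inversions σ := by
  have hlt : a < b := Fin.lt_def.2 (by omega)
  rw [Finset.ssubset_iff_of_subset]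
  · refine ⟨(σ.symm b, σ.symm a), ?_, ?_⟩
    · rw [mem_inversions]
      simpa using ⟨h, hlt⟩
    · rw [mem_inversions]
      simpa using fun _ => hlt.le
  · rintro ⟨i, j⟩ hij
    rcases Finset.mem_insert.1 (inversions_swap_mul_subset hab σ hij) with h' | h'
    · rw [Prod.mk.injEq] at h'
      rw [mem_inversions, h'.1, h'.2] at hij
      exact absurd h (lt_asymm hij.1)
    · exact h'

theorem eq_one_of_symm_lt {n : ℕ} {σ : Equiv.Perm (Fin n)}
    (h : ∀ a b : Fin n, (b : ℕ) = a + 1 → σ.symm a < σ.symm b) : σ = 1 := by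
  cases n with
  | zero => exact Subsingleton.elim _ _
  | succ n =>
    have hmono : StrictMono σ.symm :=
      Fin.strictMono_iff_lt_succ.2 fun i => h _ _ (by simp)
    have hrange : Set.range σ.symm = Set.range (id : Fin (n + 1) → Fin (n + 1)) := by
      rw [σ.symm.surjective.range_eq, Set.range_id]
    have heq := (hmono.range_inj strictMono_id).1 hrange
    ext i
    have := congrFun heq (σ i)
    simp only [Equiv.symm_apply_apply, id] at this
    rw [← this]
    rfl

/-- Sorting: unless σ = 1, some adjacent values stand in the wrong order, and exchanging them
removes an inversion. -/
theorem exists_simpleReflections_prod {n : ℕ} (σ : Equiv.Perm (Fin n)) :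
    ∃ l : List (Equiv.Perm (Fin n)), l.length ≤ (inversions σ).card ∧
      (∀ s ∈ l, s ∈ simpleReflections n) ∧ l.prod = σ := by
  induction hk : (inversions σ).card using Nat.strong_induction_on generalizing σ with
  | _ k ih =>
    subst hk
    by_cases hσ : ∀ a b : Fin n, (b : ℕ) = a + 1 → σ.symm a < σ.symm b
    · exact ⟨[], Nat.zero_le _, by simp, by rw [eq_one_of_symm_lt hσ, List.prod_nil]⟩
    · push Not at hσ
      obtain ⟨a, b, hab, hle⟩ := hσ
      have hne : b ≠ a := fun h => by rw [h] at hab; omega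
      have hlt : σ.symm b < σ.symm a := lt_of_le_of_ne hle (σ.symm.injective.ne hne)
      have hcard := Finset.card_lt_card (inversions_swap_mul_ssubset hab hlt)
      obtain ⟨l, hl, hs, hp⟩ := ih _ hcard _ rfl
      refine ⟨Equiv.swap a b :: l, ?_, ?_, ?_⟩
      · rw [List.length_cons]
        omega
      · rintro s hs'
        rcases List.mem_cons.1 hs' with rfl | h
        · exact ⟨a, b, hab, rfl⟩
        · exact hs s h
      · rw [List.prod_cons, hp, Equiv.swap_mul_self_mul]

theorem length_eq_card_inversions {n : ℕ} (σ : Equiv.Perm (Fin n)) :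
    length σ = (inversions σ).card := by
  obtain ⟨l, hl, hs, hp⟩ := exists_simpleReflections_prod σ
  refine le_antisymm ((wordLength_le l hs hp).trans hl) ?_
  obtain ⟨l', hl', hs', hp'⟩ := exists_word_length_eq l hs hp
  rw [length, ← hl', ← hp']
  exact card_inversions_prod_le l' hs'

/-! ### The reflection length of an `n`-cycle -/

theorem mem_reflections_iff {n : ℕ} {t : Equiv.Perm (Fin n)} : t ∈ reflections n ↔ t.IsSwap := by
  constructor
  · rintro ⟨_, ⟨i, j, hij, rfl⟩, hc⟩
    obtain ⟨g, rfl⟩ := isConj_iff.1 hc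
    refine ⟨g i, g j, g.injective.ne fun h => by rw [h] at hij; omega, ?_⟩
    rw [Equiv.swap_apply_apply]
  · rintro ⟨x, y, hxy, rfl⟩
    have hx := x.isLt
    have hy := y.isLt
    have hxy' : (x : ℕ) ≠ y := fun h => hxy (Fin.ext h)
    have h0 : (⟨0, by omega⟩ : Fin n) ≠ ⟨1, by omega⟩ := by simp
    exact ⟨_, ⟨⟨0, by omega⟩, ⟨1, by omega⟩, rfl, rfl⟩, Equiv.Perm.isConj_swap h0 hxy⟩

/-- The factorization is (x y z …) = (x y)(y z …), iterated. -/
theorem exists_isSwap_prod_formPerm {α : Type*} [DecidableEq α] (l : List α) (hl : l.Nodup) :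
    ∃ t : List (Equiv.Perm α), t.length = l.length - 1 ∧ (∀ s ∈ t, s.IsSwap) ∧
      t.prod = l.formPerm := by
  induction l with
  | nil => exact ⟨[], by simp⟩
  | cons x l ih =>
    cases l with
    | nil => exact ⟨[], by simp⟩
    | cons y l =>
      obtain ⟨t, ht, hs, hp⟩ := ih hl.of_cons
      refine ⟨Equiv.swap x y :: t, by simp [ht], ?_, by
        rw [List.prod_cons, hp, List.formPerm_cons_cons]⟩
      rintro s hs'
      rcases List.mem_cons.1 hs' with rfl | h
      · refine ⟨x, y, fun h => ?_, rfl⟩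
        simp [h] at hl
      · exact hs s h

/-- If a product of transpositions is transitive, there are enough of them to connect all
points. -/
theorem card_le_length_add_one_of_transitive {α : Type*} [DecidableEq α] [Nonempty α]
    (t : List (Equiv.Perm α)) (ht : ∀ s ∈ t, s.IsSwap)
    (htrans : ∀ a b : α, t.prod.SameCycle a b) : Nat.card α ≤ t.length + 1 := by
  classical
  let G : SimpleGraph α := SimpleGraph.fromRel fun a b => Equiv.swap a b ∈ t
  -- Each factor moves a point along an edge or fixes it, so products of factors stay inside a
  -- connected component.
  have hreach : ∀ t' : List (Equiv.Perm α), (∀ s ∈ t', s ∈ t) → ∀ a, G.Reachable a (t'.prod a) := by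
    intro t' ht' a
    induction t' with
    | nil => exact SimpleGraph.Reachable.refl _
    | cons s t' ih =>
      have hs : s ∈ t := ht' s List.mem_cons_self
      rw [List.prod_cons, Equiv.Perm.mul_apply]
      refine (ih fun s hs => ht' s (List.mem_cons_of_mem _ hs)).trans ?_
      obtain ⟨x, y, hxy, rfl⟩ := ht s hs
      have hadj : G.Adj x y := (SimpleGraph.fromRel_adj _ _ _).2 ⟨hxy, Or.inl hs⟩
      rw [Equiv.swap_apply_def]
      split_ifs with h1 h2
      · rw [h1]
        exact hadj.reachable
      · rw [h2]
        exact hadj.symm.reachable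
      · exact SimpleGraph.Reachable.refl _
  have hpow : ∀ (k : ℕ) (a : α), G.Reachable a ((t.prod ^ k) a) := by
    intro k a
    induction k with
    | zero => exact SimpleGraph.Reachable.refl _
    | succ k ih =>
      rw [pow_succ', Equiv.Perm.mul_apply]
      exact ih.trans (hreach t (fun _ h => h) _)
  have hconn : G.Connected := by
    refine { preconnected := fun a b => ?_, nonempty := inferInstance }
    obtain ⟨k, hk⟩ := htrans a b
    rcases Int.eq_nat_or_neg k with ⟨m, rfl | rfl⟩
    · rw [zpow_natCast] at hk
      rw [← hk]
      exact hpow m a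
    · rw [zpow_neg, zpow_natCast, Equiv.Perm.inv_eq_iff_eq] at hk
      rw [hk]
      exact (hpow m b).symm
  refine hconn.card_vert_le_card_edgeSet_add_one.trans (Nat.succ_le_succ ?_)
  -- An edge is recovered from its transposition, so there are at most as many edges as factors.
  let f : G.edgeSet → Equiv.Perm α := fun e =>
    Sym2.lift ⟨fun a b => Equiv.swap a b, Equiv.swap_comm⟩ e.1
  have hf : Function.Injective f := by
    rintro ⟨e, he⟩ ⟨e', he'⟩ h
    induction e using Sym2.ind with
    | _ a b =>
      induction e' using Sym2.ind with
      | _ c d =>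
        have hab : a ≠ b := G.ne_of_adj he
        have h' : Equiv.swap a b = Equiv.swap c d := h
        have ha := Equiv.congr_fun h' a
        rw [Equiv.swap_apply_left, Equiv.swap_apply_def] at ha
        rw [Subtype.mk.injEq, Sym2.eq_iff]
        split_ifs at ha with h1 h2
        · exact Or.inl ⟨h1, ha⟩
        · exact Or.inr ⟨h2, ha⟩
        · exact absurd ha.symm hab
  have hmem : ∀ e, f e ∈ t.toFinset := by
    rintro ⟨e, he⟩
    induction e using Sym2.ind with
    | _ a b =>
      rw [List.mem_toFinset]
      have hadj : a ≠ b ∧ (Equiv.swap a b ∈ t ∨ Equiv.swap b a ∈ t) := he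
      rcases hadj.2 with h | h
      · exact h
      · rw [Equiv.swap_comm] at h
        exact h
  have hinj : Function.Injective fun e => (⟨f e, hmem e⟩ : t.toFinset) := fun a b h =>
    hf (Subtype.ext_iff.1 h)
  refine (Nat.card_le_card_of_injective _ hinj).trans ?_
  rw [Nat.card_eq_fintype_card, Fintype.card_coe]
  exact t.toFinset_card_le

theorem sameCycle_of_isCycleOn_univ {α : Type*} {σ : Equiv.Perm α} (hσ : σ.IsCycleOn Set.univ)
    (a b : α) : σ.SameCycle a b :=
  hσ.2 (Set.mem_univ a) (Set.mem_univ b)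

theorem formPerm_cycleWord {m : ℕ} {σ : Equiv.Perm (Fin (m + 1))} (hσ : σ.IsCycleOn Set.univ)
    (a : Fin (m + 1)) : (cycleWord σ a).formPerm = σ := by
  ext b
  unfold cycleWord
  split_ifs with h
  · have hb : b = a := ((sameCycle_of_isCycleOn_univ hσ a b).eq_of_left h).symm
    rw [List.formPerm_singleton, hb, h]
    rfl
  · rw [Equiv.Perm.formPerm_toList, (sameCycle_of_isCycleOn_univ hσ a b).cycleOf_apply]

theorem nodup_cycleWord {n : ℕ} (σ : Equiv.Perm (Fin n)) (a : Fin n) : (cycleWord σ a).Nodup := by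
  unfold cycleWord
  split_ifs
  · exact List.nodup_singleton a
  · exact Equiv.Perm.nodup_toList σ a

theorem length_cycleWord {m : ℕ} {σ : Equiv.Perm (Fin (m + 1))} (hσ : σ.IsCycleOn Set.univ)
    (a : Fin (m + 1)) : (cycleWord σ a).length = m + 1 := by
  have h := Fintype.card_congr (List.Nodup.getEquivOfForallMemList (cycleWord σ a)
    (nodup_cycleWord σ a) fun b => (mem_cycleWord σ a b).2 (sameCycle_of_isCycleOn_univ hσ a b))
  simpa using h

theorem reflectionLength_of_isCycleOn_univ {m : ℕ} {σ : Equiv.Perm (Fin (m + 1))}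
    (hσ : σ.IsCycleOn Set.univ) : reflectionLength σ = m := by
  obtain ⟨t, ht, hs, hp⟩ := exists_isSwap_prod_formPerm _ (nodup_cycleWord σ 0)
  rw [formPerm_cycleWord hσ] at hp
  rw [length_cycleWord hσ] at ht
  have hs' : ∀ s ∈ t, s ∈ reflections (m + 1) := fun s h => mem_reflections_iff.2 (hs s h)
  refine le_antisymm ((wordLength_le t hs' hp).trans ht.le) ?_
  obtain ⟨l, hl, hr, hlp⟩ := exists_word_length_eq t hs' hp
  rw [reflectionLength, ← hl]
  have := card_le_length_add_one_of_transitive l (fun s h => mem_reflections_iff.1 (hr s h))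
    (by rw [hlp]; exact sameCycle_of_isCycleOn_univ hσ)
  rw [Nat.card_eq_fintype_card, Fintype.card_fin] at this
  omega

/-! ### The word of an `n`-cycle -/

theorem getElem_cycleWord {n : ℕ} (σ : Equiv.Perm (Fin n)) (a : Fin n) (k : ℕ)
    (hk : k < (cycleWord σ a).length) : (cycleWord σ a)[k] = (σ ^ k) a := by
  by_cases h : σ a = a
  · have hk' : (σ ^ k) a = a := Equiv.Perm.pow_apply_eq_self_of_apply_eq_self h k
    simp [cycleWord, h, hk']
  · simp [cycleWord, h, Equiv.Perm.getElem_toList]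

/-- With a single cycle, only the last point is a cycle maximum; every other block of the word is
empty. -/
theorem fundamentalWord_of_isCycleOn_univ {m : ℕ} {σ : Equiv.Perm (Fin (m + 1))}
    (hσ : σ.IsCycleOn Set.univ) : fundamentalWord σ = cycleWord σ (Fin.last m) := by
  have hmax : IsCycleMax σ (Fin.last m) := fun b _ => Fin.le_last b
  rw [fundamentalWord, List.finRange_succ_last, List.flatMap_append, List.flatMap_singleton,
    if_pos hmax]
  convert List.nil_append _
  rw [List.flatMap_eq_nil_iff]
  intro a ha
  obtain ⟨b, _, rfl⟩ := List.mem_map.1 ha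
  refine if_neg fun h => ?_
  exact absurd (h (Fin.last m) (sameCycle_of_isCycleOn_univ hσ _ _))
    (not_le.2 (Fin.castSucc_lt_last b))

theorem fundamental_apply_of_isCycleOn_univ {m : ℕ} {σ : Equiv.Perm (Fin (m + 1))}
    (hσ : σ.IsCycleOn Set.univ) (i : Fin (m + 1)) :
    fundamental σ i = (σ ^ (i : ℕ)) (Fin.last m) := by
  have h1 : fundamental σ i = (fundamentalWord σ)[(i : ℕ)]'(by
    rw [length_fundamentalWord]; exact i.isLt) := rfl
  rw [h1]
  simp only [fundamentalWord_of_isCycleOn_univ hσ]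
  rw [getElem_cycleWord]

end PermStat

namespace PermStat
open Finset

/-! ### Counting arcs of a closed word

A word `w 0, w 1, …, w (n - 1)` starting with its strict maximum and closed up by `w n = w 0`. -/

/-- A closed word without repetitions whose first letter is the largest one. -/
structure IsMaxWord (n : ℕ) (w : ℕ → ℕ) : Prop where
  inj : ∀ i < n, ∀ j < n, w i = w j → i = j
  le : ∀ i, w i ≤ w 0
  closed : w n = w 0

/-- The number of pairs `i < j < n` satisfying `P`. -/
def pairCount (n : ℕ) (P : ℕ → ℕ → Prop) [∀ i j, Decidable (P i j)] : ℤ :=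
  ∑ j ∈ range n, ∑ i ∈ range j, if P i j then 1 else 0

theorem IsMaxWord.lt {n : ℕ} {w : ℕ → ℕ} (h : IsMaxWord n w) {i : ℕ} (hi : 0 < i) (hin : i < n) :
    w i < w 0 :=
  lt_of_le_of_ne (h.le i) fun e => hi.ne' (h.inj i hin 0 (hi.trans hin) e)

theorem pairCount_swap (n : ℕ) (P : ℕ → ℕ → Prop) [∀ i j, Decidable (P i j)] :
    pairCount n P = ∑ i ∈ range n, ∑ j ∈ Ico (i + 1) n, if P i j then 1 else 0 := by
  unfold pairCount
  refine Finset.sum_comm' fun i j => ?_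
  simp only [mem_range, mem_Ico]
  omega

/-- The arcs before the arc `j` that are inverted with it, for a fixed `j`. -/
theorem IsMaxWord.sum_inversions {n : ℕ} {w : ℕ → ℕ} (h : IsMaxWord n w) {j : ℕ} (hj : j < n) :
    (∑ i ∈ range j, if (w i < w j ∧ w (j + 1) < w (i + 1)) ∨ (w j < w i ∧ w (i + 1) < w (j + 1))
      then (1 : ℤ) else 0) =
    2 * (∑ i ∈ range j,
      if w i < w j ∧ w j < w (j + 1) ∧ w (j + 1) < w (i + 1) then (1 : ℤ) else 0) +
    2 * (∑ i ∈ range j,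
      if w (i + 1) < w (j + 1) ∧ w (j + 1) < w j ∧ w j < w i then (1 : ℤ) else 0) +
    (∑ i ∈ range j, if w (j + 1) < w i ∧ w i < w j then (1 : ℤ) else 0) +
    (∑ i ∈ range j, if w j < w i ∧ w i < w (j + 1) then (1 : ℤ) else 0) +
    if w j < w (j + 1) then 1 else 0 := by
  rcases Nat.eq_zero_or_pos j with rfl | hj0
  · have := h.le 1
    simp [not_lt.2 this]
  have hu : ∀ i < j, w i ≠ w j := fun i hi e => hi.ne (h.inj i (hi.trans hj) j hj e)
  have hv : ∀ i < j, w (i + 1) ≠ w (j + 1) := by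
    intro i hi e
    rcases Nat.lt_or_ge (j + 1) n with hjn | hjn
    · have := h.inj (i + 1) (by omega) (j + 1) hjn e
      omega
    · have hjn' : j + 1 = n := by omega
      have := h.lt (i := i + 1) (by omega) (by omega)
      rw [e, hjn', h.closed] at this
      exact lt_irrefl _ this
  have hj1 : w j < w 0 := h.lt hj0 hj
  have hj2 := h.le (j + 1)
  rw [mul_sum, mul_sum]
  by_cases hup : w j < w (j + 1)
  -- From w 0 to w j the word passes from at least the level w (j + 1) to below it: one net downward
  -- crossing. This replaces the ascent term, and the identity then holds for each i separately.
  · have htel := sum_range_sub' (fun i => if w (j + 1) ≤ w i then (1 : ℤ) else 0) j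
    rw [if_pos hj2, if_neg (not_le.2 hup), sub_zero] at htel
    rw [if_pos hup, ← htel, ← sum_add_distrib, ← sum_add_distrib, ← sum_add_distrib,
      ← sum_add_distrib]
    refine sum_congr rfl fun i hi => ?_
    have h1 := hu i (mem_range.1 hi)
    have h2 := hv i (mem_range.1 hi)
    have hM : ¬ (w (j + 1) < w i ∧ w i < w j) := by omega
    simp only [hup, hup.not_gt, hM, true_and, false_and, and_false, if_false, mul_zero, add_zero]
    split_ifs <;> first | rfl | omega
  -- Both w 0 and w j are at or above the level w (j + 1), so the net crossing is 0. The closing arc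
  -- rises, so it does not occur here.
  · have htel := sum_range_sub' (fun i => if w i < w (j + 1) then (1 : ℤ) else 0) j
    have hjn : j + 1 < n := by
      by_contra hge
      have hjn' : j + 1 = n := by omega
      rw [hjn', h.closed] at hup
      exact hup hj1
    have hne : ∀ i < j + 1, w i ≠ w (j + 1) := fun i hi e =>
      hi.ne (h.inj i (hi.trans hjn) (j + 1) hjn e)
    have hne' := hne j (Nat.lt_succ_self j)
    rw [if_neg (not_lt.2 hj2), if_neg hup, sub_zero] at htel
    rw [if_neg hup, ← htel, ← sum_add_distrib, ← sum_add_distrib, ← sum_add_distrib,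
      ← sum_add_distrib]
    refine sum_congr rfl fun i hi => ?_
    have h1 := hu i (mem_range.1 hi)
    have h2 := hv i (mem_range.1 hi)
    have h3 := hne i ((mem_range.1 hi).trans (Nat.lt_succ_self j))
    have hdown : w (j + 1) < w j := lt_of_le_of_ne (not_lt.1 hup) hne'.symm
    have hM : ¬ (w j < w i ∧ w i < w (j + 1)) := by omega
    simp only [hup, hdown, hM, true_and, false_and, and_false, if_false]
    split_ifs <;> first | rfl | omega

/-- After the letter `w i`, the arcs passing upwards over it outnumber those passing downwards
by one if and only if the word descends after `w i`. -/
theorem IsMaxWord.sum_ascents_over {n : ℕ} {w : ℕ → ℕ} (h : IsMaxWord n w) {i : ℕ} (hi0 : 0 < i)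
    (hin : i < n) :
    (∑ j ∈ Ico (i + 1) n, if w j < w i ∧ w i < w (j + 1) then (1 : ℤ) else 0) +
      (if w i < w (i + 1) then 1 else 0) =
    (∑ j ∈ Ico (i + 1) n, if w (j + 1) < w i ∧ w i < w j then (1 : ℤ) else 0) + 1 := by
  have htel := sum_Ico_sub (fun j => if w i < w j then (1 : ℤ) else 0)
    (show i + 1 ≤ n by omega)
  have hlast : w i < w n := by
    rw [h.closed]
    exact h.lt hi0 hin
  rw [if_pos hlast] at htel
  rw [← sub_eq_zero, add_sub_add_comm, ← sum_sub_distrib, ← neg_sub 1, ← htel, ← sub_eq_add_neg,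
    sub_eq_zero]
  refine sum_congr rfl fun j hj => ?_
  rw [mem_Ico] at hj
  have h1 : w j ≠ w i := fun e => by
    have := h.inj j hj.2 i hin e
    omega
  have h2 : w (j + 1) ≠ w i := fun e => by
    rcases Nat.lt_or_ge (j + 1) n with hjn | hjn
    · have := h.inj (j + 1) hjn i hin e
      omega
    · have hjn' : j + 1 = n := by omega
      rw [hjn'] at e
      exact hlast.ne' e
  split_ifs <;> first | rfl | omega

theorem IsMaxWord.pairCount_ascents {m : ℕ} {w : ℕ → ℕ} (h : IsMaxWord (m + 1) w) :
    pairCount (m + 1) (fun i j => w j < w i ∧ w i < w (j + 1)) +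
      (∑ j ∈ range (m + 1), if w j < w (j + 1) then (1 : ℤ) else 0) =
    pairCount (m + 1) (fun i j => w (j + 1) < w i ∧ w i < w j) + m := by
  rw [pairCount_swap, pairCount_swap, sum_range_succ', sum_range_succ' (n := m),
    sum_range_succ' (n := m)]
  -- Nothing passes over the maximum w 0 and no ascent starts there, so the index 0 contributes
  -- nothing.
  have h0 : ∀ j, ¬ (w 0 < w j) := fun j => not_lt.2 (h.le j)
  simp only [h0, and_false, if_false, sum_const_zero, add_zero]
  rw [← sum_add_distrib]
  have hm : (m : ℤ) = ∑ i ∈ range m, 1 := by simp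
  rw [hm, ← sum_add_distrib]
  exact sum_congr rfl fun i hi =>
    h.sum_ascents_over (Nat.succ_pos i) (by rw [mem_range] at hi; omega)

/-- In the sum over j, the upward crossings and ascents are exchanged for a second copy of the
downward crossings plus m. -/
theorem IsMaxWord.pairCount_inversions {m : ℕ} {w : ℕ → ℕ} (h : IsMaxWord (m + 1) w) :
    pairCount (m + 1) (fun i j =>
      (w i < w j ∧ w (j + 1) < w (i + 1)) ∨ (w j < w i ∧ w (i + 1) < w (j + 1))) =
    m + 2 * (pairCount (m + 1) (fun i j => w (j + 1) < w i ∧ w i < w j) +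
      pairCount (m + 1) (fun i j => w i < w j ∧ w j < w (j + 1) ∧ w (j + 1) < w (i + 1)) +
      pairCount (m + 1) (fun i j => w (i + 1) < w (j + 1) ∧ w (j + 1) < w j ∧ w j < w i)) := by
  have key := sum_congr rfl fun j (hj : j ∈ range (m + 1)) => h.sum_inversions (mem_range.1 hj)
  simp only [sum_add_distrib, ← mul_sum] at key
  have := h.pairCount_ascents
  unfold pairCount at *
  linarith

/-- The arcs before the letter `w (j + 1)` passing downwards over it, or ending there. -/
theorem IsMaxWord.sum_descents_over {n : ℕ} {w : ℕ → ℕ} (h : IsMaxWord n w) {j : ℕ}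
    (hj : j + 1 < n) :
    (∑ i ∈ range (j + 1), if w (i + 1) ≤ w (j + 1) ∧ w (j + 1) < w i then (1 : ℤ) else 0) =
    1 + ((∑ i ∈ range j,
      if w i < w j ∧ w j < w (j + 1) ∧ w (j + 1) < w (i + 1) then (1 : ℤ) else 0) +
    (∑ i ∈ range j,
      if w (i + 1) < w (j + 1) ∧ w (j + 1) < w j ∧ w j < w i then (1 : ℤ) else 0) +
    (∑ i ∈ range j,
      if w j < w i ∧ w i < w (j + 1) ∧ w (j + 1) < w (i + 1) then (1 : ℤ) else 0) +
    (∑ i ∈ range j,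
      if w (i + 1) < w (j + 1) ∧ w (j + 1) < w i ∧ w i < w j then (1 : ℤ) else 0)) := by
  have hne : ∀ i < j, w i ≠ w j := fun i hi e => by
    have := h.inj i (by omega) j (by omega) e
    omega
  have hne' : ∀ i ≤ j, w i ≠ w (j + 1) := fun i hi e => by
    have := h.inj i (by omega) (j + 1) hj e
    omega
  have h0 : w (j + 1) < w 0 := h.lt (Nat.succ_pos j) hj
  have hjj := hne' j le_rfl
  rw [← sum_add_distrib, ← sum_add_distrib, ← sum_add_distrib, sum_range_succ]
  by_cases hup : w j < w (j + 1)
  -- Before a rise, downward crossings of the level w (j + 1) exceed upward ones by 1. The upward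
  -- ones form 14-23 or 24-13 with arc j, according to whether w i is below or above w j.
  · have htel := sum_range_sub' (fun i => if w (j + 1) < w i then (1 : ℤ) else 0) j
    rw [if_pos h0, if_neg (not_lt.2 hup.le), sub_zero] at htel
    rw [if_neg (by omega), add_zero, ← htel, ← sum_add_distrib]
    refine sum_congr rfl fun i hi => ?_
    have h1 := hne i (mem_range.1 hi)
    have h2 := hne' i (mem_range.1 hi).le
    have h3 := hne' (i + 1) (mem_range.1 hi)
    split_ifs <;> first | rfl | omega
  -- Arc j itself ends at w (j + 1) and gives the 1. The earlier downward crossings form 41-32 or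
  -- 31-42 with it.
  · rw [if_pos ⟨le_rfl, by omega⟩, add_comm, add_right_inj]
    refine sum_congr rfl fun i hi => ?_
    have h1 := hne i (mem_range.1 hi)
    have h2 := hne' i (mem_range.1 hi).le
    have h3 := hne' (i + 1) (mem_range.1 hi)
    split_ifs <;> first | rfl | omega

theorem IsMaxWord.sum_descent_sizes {m : ℕ} {w : ℕ → ℕ} (h : IsMaxWord (m + 1) w) :
    (∑ j ∈ range (m + 1), ∑ i ∈ range (m + 1),
      if w (j + 1) ≤ w i ∧ w i < w j then (1 : ℤ) else 0) =
    m + (pairCount (m + 1) (fun i j => w (j + 1) < w i ∧ w i < w j) +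
      pairCount m (fun i j => w i < w j ∧ w j < w (j + 1) ∧ w (j + 1) < w (i + 1)) +
      pairCount m (fun i j => w (i + 1) < w (j + 1) ∧ w (j + 1) < w j ∧ w j < w i) +
      pairCount m (fun i j => w j < w i ∧ w i < w (j + 1) ∧ w (j + 1) < w (i + 1)) +
      pairCount m (fun i j => w (i + 1) < w (j + 1) ∧ w (j + 1) < w i ∧ w i < w j)) := by
  have hsplit : ∀ j ∈ range (m + 1), (∑ i ∈ range (m + 1),
      if w (j + 1) ≤ w i ∧ w i < w j then (1 : ℤ) else 0) =
      (∑ i ∈ range j, if w (j + 1) < w i ∧ w i < w j then (1 : ℤ) else 0) +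
      ∑ i ∈ Ico (j + 1) (m + 1), if w (j + 1) ≤ w i ∧ w i < w j then (1 : ℤ) else 0 := by
    intro j hj
    rw [mem_range] at hj
    rw [← sum_range_add_sum_Ico _ hj, sum_range_succ, if_neg (fun h => lt_irrefl _ h.2), add_zero]
    congr 1
    refine sum_congr rfl fun i hi => ?_
    rw [mem_range] at hi
    -- An earlier letter can be the target only for the closing arc, which does not fall.
    have hne : w i < w j → w (j + 1) ≠ w i := fun hlt e => by
      rcases Nat.lt_or_ge (j + 1) (m + 1) with hjn | hjn
      · have := h.inj (j + 1) hjn i (by omega) e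
        omega
      · have hjn' : j + 1 = m + 1 := by omega
        rw [hjn', h.closed] at e
        exact absurd (h.le j) (by omega)
    split_ifs <;> first | rfl | omega
  rw [sum_congr rfl hsplit, sum_add_distrib]
  have hswap : (∑ j ∈ range (m + 1), ∑ i ∈ Ico (j + 1) (m + 1),
      if w (j + 1) ≤ w i ∧ w i < w j then (1 : ℤ) else 0) =
      pairCount (m + 1) (fun j i => w (j + 1) ≤ w i ∧ w i < w j) := (pairCount_swap _ _).symm
  have hm : (m : ℤ) = ∑ i ∈ range m, 1 := by simp
  rw [hswap, hm]
  unfold pairCount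
  -- Letters are reindexed as w (j + 1), since no arc precedes w 0.
  rw [sum_range_succ' (n := m) (f := fun j => ∑ i ∈ range j,
      if w (i + 1) ≤ w j ∧ w j < w i then (1 : ℤ) else 0), range_zero, sum_empty, add_zero,
    sum_congr rfl fun j hj => h.sum_descents_over (j := j) (by rw [mem_range] at hj; omega)]
  simp only [sum_add_distrib]
  ring

end PermStat

namespace PermStat
open Finset

/-! ### Manipulating pair counts -/

theorem pairCount_succ_of_forall_not (n : ℕ) (P : ℕ → ℕ → Prop) [∀ i j, Decidable (P i j)]
    (h : ∀ i < n, ¬ P i n) : pairCount (n + 1) P = pairCount n P := by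
  unfold pairCount
  rw [sum_range_succ, sum_eq_zero fun i hi => if_neg (h i (mem_range.1 hi)), add_zero]

theorem pairCount_eq_card (n : ℕ) (P : ℕ → ℕ → Prop) [∀ i j, Decidable (P i j)] :
    pairCount n P = (((range n).sigma fun j => range j).filter fun x => P x.2 x.1).card := by
  rw [pairCount, sum_sigma', sum_boole]

/-- Passes from pairs ordered by value, as inversions are, to pairs ordered by place in the word. -/
theorem sum_sum_eq_pairCount (n : ℕ) (P Q : ℕ → ℕ → Prop) [∀ i j, Decidable (P i j)]
    [∀ i j, Decidable (Q i j)] (hP : ∀ i < n, ¬ P i i) (hPQ : ∀ i j, Q i j ↔ P i j ∨ P j i)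
    (hasymm : ∀ i j, P i j → ¬ P j i) :
    (∑ j ∈ range n, ∑ i ∈ range n, if P i j then (1 : ℤ) else 0) = pairCount n Q := by
  have h1 : ∀ j ∈ range n, (∑ i ∈ range n, if P i j then (1 : ℤ) else 0) =
      (∑ i ∈ range j, if P i j then (1 : ℤ) else 0) +
      ∑ i ∈ Ico (j + 1) n, if P i j then (1 : ℤ) else 0 := by
    intro j hj
    rw [mem_range] at hj
    rw [← sum_range_add_sum_Ico _ hj, sum_range_succ, if_neg (hP j hj), add_zero]
  rw [sum_congr rfl h1, sum_add_distrib, ← pairCount_swap n fun i j => P j i]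
  unfold pairCount
  rw [← sum_add_distrib]
  refine sum_congr rfl fun j _ => ?_
  rw [← sum_add_distrib]
  refine sum_congr rfl fun i _ => ?_
  have := hPQ i j
  have := hasymm i j
  by_cases h2 : P i j <;> by_cases h3 : P j i <;> simp_all

/-! ### Pattern counts as pair counts -/

section Patterns

variable {m : ℕ} {w : ℕ → ℕ} {τ : Equiv.Perm (Fin (m + 1))}

/-- The bonds make an occurrence determined by the first positions i and j of its two blocks; `i + 1
< j` says that the blocks are disjoint. -/
theorem patternCount_bonded_pairs (hτ : ∀ i, (τ i : ℕ) = w i) (p : VincularPattern 4)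
    (hb : p.bonds = {0, 2}) (P : ℕ → ℕ → Prop) [∀ i j, Decidable (P i j)]
    (hP : ∀ i j, i < j → (P i j ↔ i + 1 < j ∧ ∀ a b : Fin 4,
      (![w i, w (i + 1), w j, w (j + 1)] a ≤ ![w i, w (i + 1), w j, w (j + 1)] b ↔
        p.perm a ≤ p.perm b))) :
    (patternCount p τ : ℤ) = pairCount m P := by
  have hocc : ∀ e : Fin 4 → Fin (m + 1), IsOccurrence p τ e → (e 1 : ℕ) = e 0 + 1 ∧
      (e 3 : ℕ) = e 2 + 1 ∧ (e 1 : ℕ) < e 2 := by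
    rintro e ⟨h1, -, h3⟩
    rw [hb] at h3
    exact ⟨h3 0 1 (by simp) rfl, h3 2 3 (by simp) rfl, h1 1 2 (by decide)⟩
  have hvec : ∀ (e : Fin 4 → Fin (m + 1)), (e 1 : ℕ) = e 0 + 1 → (e 3 : ℕ) = e 2 + 1 →
      ∀ a, (τ (e a) : ℕ) = ![w (e 0), w (e 0 + 1), w (e 2), w (e 2 + 1)] a := by
    intro e h1 h3 a
    rw [hτ]
    fin_cases a <;> simp [h1, h3]
  rw [pairCount_eq_card, patternCount, Nat.cast_inj]
  refine card_bij (fun e _ => ⟨(e 2 : ℕ), (e 0 : ℕ)⟩) ?_ ?_ ?_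
  · intro e he
    rw [mem_filter] at he
    obtain ⟨h1, h3, h2⟩ := hocc e he.2
    have hlt := (e 3).isLt
    have h02 : (e 0 : ℕ) < e 2 := by omega
    simp only [mem_filter, mem_sigma, mem_range]
    refine ⟨⟨by omega, h02⟩, (hP _ _ h02).2 ⟨by omega, fun a b => ?_⟩⟩
    rw [← hvec e h1 h3, ← hvec e h1 h3]
    exact he.2.2.1 a b
  · intro e he e' he' h
    rw [mem_filter] at he he'
    obtain ⟨h1, h3, -⟩ := hocc e he.2
    obtain ⟨h1', h3', -⟩ := hocc e' he'.2
    simp only [Sigma.mk.injEq, heq_eq_eq] at h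
    funext a
    rw [Fin.ext_iff]
    fin_cases a
    · exact h.2
    · exact (h1.trans (by rw [h.2])).trans h1'.symm
    · exact h.1
    · exact (h3.trans (by rw [h.1])).trans h3'.symm
  · rintro ⟨j, i⟩ hx
    simp only [mem_filter, mem_sigma, mem_range] at hx
    obtain ⟨⟨hj, hij⟩, hx⟩ := hx
    obtain ⟨hij', hord⟩ := (hP _ _ hij).1 hx
    let e : Fin 4 → Fin (m + 1) := ![⟨i, by omega⟩, ⟨i + 1, by omega⟩, ⟨j, by omega⟩,
      ⟨j + 1, by omega⟩]
    refine ⟨e, mem_filter.2 ⟨mem_univ _, ?_, fun a b => ?_, ?_⟩, rfl⟩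
    · intro a b hab
      rw [Fin.lt_def]
      fin_cases a <;> fin_cases b <;> simp [e] at hab ⊢ <;> omega
    · rw [← hord a b, Fin.le_def, hvec e rfl rfl, hvec e rfl rfl]
      rfl
    · intro a b ha hab
      rw [hb] at ha
      fin_cases a <;> fin_cases b <;> simp [e] at ha hab ⊢

theorem patternCount_pat2_31 (hτ : ∀ i, (τ i : ℕ) = w i) :
    (patternCount pat2_31 τ : ℤ) = pairCount m fun i j => w (j + 1) < w i ∧ w i < w j := by
  have hbond : ∀ e : Fin 3 → Fin (m + 1), IsOccurrence pat2_31 τ e → (e 2 : ℕ) = e 1 + 1 :=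
    fun e he => he.2.2 1 2 (by simp [pat2_31]) rfl
  have hiff : ∀ e : Fin 3 → Fin (m + 1), (e 2 : ℕ) = e 1 + 1 →
      ((∀ a b, τ (e a) ≤ τ (e b) ↔ pat2_31.perm a ≤ pat2_31.perm b) ↔
        w (e 1 + 1) < w (e 0) ∧ w (e 0) < w (e 1)) := by
    intro e h2
    simp only [Fin.le_def, hτ, Fin.forall_fin_succ, pat2_31, Equiv.coe_fn_mk]
    simp [h2]
    omega
  rw [pairCount_eq_card, patternCount, Nat.cast_inj]
  refine card_bij (fun e _ => ⟨(e 1 : ℕ), (e 0 : ℕ)⟩) ?_ ?_ ?_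
  · intro e he
    rw [mem_filter] at he
    have h2 := hbond e he.2
    have hlt := (e 2).isLt
    have h01 : e 0 < e 1 := he.2.1 0 1 (by decide)
    simp only [mem_filter, mem_sigma, mem_range]
    exact ⟨⟨by omega, h01⟩, (hiff e h2).1 he.2.2.1⟩
  · intro e he e' he' h
    rw [mem_filter] at he he'
    have h2 := hbond e he.2
    have h2' := hbond e' he'.2
    simp only [Sigma.mk.injEq, heq_eq_eq] at h
    funext a
    rw [Fin.ext_iff]
    fin_cases a
    · exact h.2
    · exact h.1
    · exact (h2.trans (by rw [h.1])).trans h2'.symm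
  · rintro ⟨j, i⟩ hx
    simp only [mem_filter, mem_sigma, mem_range] at hx
    obtain ⟨⟨hj, hij⟩, hx⟩ := hx
    let e : Fin 3 → Fin (m + 1) := ![⟨i, by omega⟩, ⟨j, by omega⟩, ⟨j + 1, by omega⟩]
    refine ⟨e, mem_filter.2 ⟨mem_univ _, ?_, (hiff e rfl).2 hx, ?_⟩, rfl⟩
    · intro a b hab
      rw [Fin.lt_def]
      fin_cases a <;> fin_cases b <;> simp [e] at hab ⊢ <;> omega
    · intro a b ha hab
      fin_cases a <;> fin_cases b <;> simp [e, pat2_31] at ha hab ⊢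

theorem patternCount_pat14_23 (hτ : ∀ i, (τ i : ℕ) = w i) :
    (patternCount pat14_23 τ : ℤ) =
      pairCount m fun i j => w i < w j ∧ w j < w (j + 1) ∧ w (j + 1) < w (i + 1) := by
  refine patternCount_bonded_pairs hτ _ rfl _ fun i j hij => ?_
  -- The strict inequalities already exclude overlapping blocks; the same holds for the other three
  -- bonded patterns.
  have hne : w j < w (i + 1) → i + 1 ≠ j := by
    rintro h rfl
    exact lt_irrefl _ h
  simp [Fin.forall_fin_succ, pat14_23]
  omega

theorem patternCount_pat41_32 (hτ : ∀ i, (τ i : ℕ) = w i) :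
    (patternCount pat41_32 τ : ℤ) =
      pairCount m fun i j => w (i + 1) < w (j + 1) ∧ w (j + 1) < w j ∧ w j < w i := by
  refine patternCount_bonded_pairs hτ _ rfl _ fun i j hij => ?_
  have hne : w (i + 1) < w j → i + 1 ≠ j := by
    rintro h rfl
    exact lt_irrefl _ h
  simp [Fin.forall_fin_succ, pat41_32]
  omega

theorem patternCount_pat24_13 (hτ : ∀ i, (τ i : ℕ) = w i) :
    (patternCount pat24_13 τ : ℤ) =
      pairCount m fun i j => w j < w i ∧ w i < w (j + 1) ∧ w (j + 1) < w (i + 1) := by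
  refine patternCount_bonded_pairs hτ _ rfl _ fun i j hij => ?_
  have hne : w j < w (i + 1) → i + 1 ≠ j := by
    rintro h rfl
    exact lt_irrefl _ h
  simp [Fin.forall_fin_succ, pat24_13]
  omega

theorem patternCount_pat31_42 (hτ : ∀ i, (τ i : ℕ) = w i) :
    (patternCount pat31_42 τ : ℤ) =
      pairCount m fun i j => w (i + 1) < w (j + 1) ∧ w (j + 1) < w i ∧ w i < w j := by
  refine patternCount_bonded_pairs hτ _ rfl _ fun i j hij => ?_
  have hne : w (i + 1) < w j → i + 1 ≠ j := by
    rintro h rfl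
    exact lt_irrefl _ h
  simp [Fin.forall_fin_succ, pat31_42]
  omega

theorem avoids_iff_patternCount_eq_zero {k n : ℕ} (p : VincularPattern k)
    (τ : Equiv.Perm (Fin n)) : Avoids τ p ↔ patternCount p τ = 0 := by
  simp [Avoids, patternCount, filter_eq_empty_iff]

end Patterns

/-! ### The word and the statistics of an `n`-cycle -/

section Cycle

variable {m : ℕ} {σ : Equiv.Perm (Fin (m + 1))}

/-- The orbit of the largest point. -/
def orbitWord (σ : Equiv.Perm (Fin (m + 1))) (k : ℕ) : ℕ := ((σ ^ k) (Fin.last m) : Fin (m + 1))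

theorem isMaxWord_orbitWord (hσ : σ.IsCycleOn Set.univ) :
    IsMaxWord (m + 1) (orbitWord σ) where
  inj i hi j hj h := by
    have h' := Fin.ext h
    have hfi := fundamental_apply_of_isCycleOn_univ hσ ⟨i, hi⟩
    have hfj := fundamental_apply_of_isCycleOn_univ hσ ⟨j, hj⟩
    exact Fin.ext_iff.1 ((fundamental σ).injective (hfi.trans (h'.trans hfj.symm)))
  le i := Fin.le_last _
  closed := by
    have hσ' : σ.IsCycleOn ((univ : Finset (Fin (m + 1))) : Set (Fin (m + 1))) := by
      rwa [coe_univ]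
    have := hσ'.pow_card_apply (mem_univ (Fin.last m))
    rw [card_univ, Fintype.card_fin] at this
    rw [orbitWord, this]
    rfl

theorem sum_orbit {M : Type*} [AddCommMonoid M] (hσ : σ.IsCycleOn Set.univ)
    (f : Fin (m + 1) → M) :
    ∑ x, f x = ∑ k ∈ range (m + 1), f ((σ ^ k) (Fin.last m)) := by
  rw [← Equiv.sum_comp (fundamental σ), ← Fin.sum_univ_eq_sum_range]
  exact sum_congr rfl fun i _ => by rw [fundamental_apply_of_isCycleOn_univ hσ]

theorem val_apply_pow (σ : Equiv.Perm (Fin (m + 1))) (k : ℕ) :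
    ((σ ((σ ^ k) (Fin.last m)) : Fin (m + 1)) : ℕ) = orbitWord σ (k + 1) := by
  rw [orbitWord, pow_succ', Equiv.Perm.mul_apply]

theorem card_inversions_eq_pairCount (hσ : σ.IsCycleOn Set.univ) :
    ((inversions σ).card : ℤ) = pairCount (m + 1) (fun i j =>
      (orbitWord σ i < orbitWord σ j ∧ orbitWord σ (j + 1) < orbitWord σ (i + 1)) ∨
      (orbitWord σ j < orbitWord σ i ∧ orbitWord σ (i + 1) < orbitWord σ (j + 1))) := by
  rw [← sum_sum_eq_pairCount (m + 1)
    (fun i j => orbitWord σ i < orbitWord σ j ∧ orbitWord σ (j + 1) < orbitWord σ (i + 1))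
    _ (fun i _ h => lt_irrefl _ h.1) (fun i j => Iff.rfl) (fun i j h h' => lt_asymm h.1 h'.1),
    inversions, ← sum_boole, Fintype.sum_prod_type_right, sum_orbit hσ]
  refine sum_congr rfl fun j _ => ?_
  rw [sum_orbit hσ]
  refine sum_congr rfl fun i _ => ?_
  simp only [Fin.lt_def, val_apply_pow]
  rfl

/-- The displacements σ(x) - x sum to zero, so total rise equals total drop. Truncated subtraction
discards the terms of the wrong sign. -/
theorem depth_eq_sum {n : ℕ} (σ : Equiv.Perm (Fin n)) :
    depth σ = ∑ x : Fin n, ((x : ℕ) - (σ x : ℕ)) := by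
  have h1 : depth σ = ∑ x : Fin n, ((σ x : ℕ) - (x : ℕ)) := by
    rw [depth, sum_filter]
    refine sum_congr rfl fun x _ => ?_
    split_ifs with h
    · rfl
    · rw [Fin.lt_def] at h
      omega
  have h2 : ∑ x : Fin n, (σ x : ℕ) = ∑ x : Fin n, (x : ℕ) :=
    Equiv.sum_comp σ fun x : Fin n => (x : ℕ)
  have h3 : ∑ x : Fin n, (((σ x : ℕ) - (x : ℕ)) + (x : ℕ)) =
      ∑ x : Fin n, (((x : ℕ) - (σ x : ℕ)) + (σ x : ℕ)) :=
    sum_congr rfl fun x _ => by omega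
  rw [sum_add_distrib, sum_add_distrib, h2] at h3
  rw [h1]
  exact Nat.add_right_cancel h3

/-- A drop from b to a is the number of points of [a, b), and every point is a letter of the word.
-/
theorem depth_eq_sum_descents (hσ : σ.IsCycleOn Set.univ) :
    (depth σ : ℤ) = ∑ j ∈ range (m + 1), ∑ i ∈ range (m + 1),
      if orbitWord σ (j + 1) ≤ orbitWord σ i ∧ orbitWord σ i < orbitWord σ j
        then (1 : ℤ) else 0 := by
  have h1 : ∀ a b : Fin (m + 1), (((b : ℕ) - (a : ℕ) : ℕ) : ℤ) =
      ∑ x : Fin (m + 1), if a ≤ x ∧ x < b then (1 : ℤ) else 0 := by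
    intro a b
    rw [sum_boole, ← Fin.card_Ico]
    congr 2
    ext x
    simp
  rw [depth_eq_sum, Nat.cast_sum, sum_orbit hσ]
  refine sum_congr rfl fun j _ => ?_
  rw [h1, sum_orbit hσ]
  refine sum_congr rfl fun i _ => ?_
  simp only [Fin.lt_def, Fin.le_def, val_apply_pow]
  rfl

theorem length_and_depth_of_isCycleOn_univ (hσ : σ.IsCycleOn Set.univ) :
    (length σ : ℤ) = m + 2 * (patternCount pat2_31 (fundamental σ) +
      patternCount pat14_23 (fundamental σ) + patternCount pat41_32 (fundamental σ)) ∧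
    (depth σ : ℤ) = m + (patternCount pat2_31 (fundamental σ) +
      patternCount pat14_23 (fundamental σ) + patternCount pat41_32 (fundamental σ) +
      patternCount pat24_13 (fundamental σ) + patternCount pat31_42 (fundamental σ)) := by
  have hτ : ∀ i, (fundamental σ i : ℕ) = orbitWord σ i := fun i => by
    rw [fundamental_apply_of_isCycleOn_univ hσ]
    rfl
  have hw := isMaxWord_orbitWord hσ
  have hlast : ∀ k, ¬ orbitWord σ (m + 1) < orbitWord σ k := fun k => by
    rw [hw.closed]
    exact not_lt.2 (hw.le k)
  rw [patternCount_pat2_31 hτ, patternCount_pat14_23 hτ, patternCount_pat41_32 hτ,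
    patternCount_pat24_13 hτ, patternCount_pat31_42 hτ]
  constructor
  -- The closing arc ends at the maximum, which rules it out as second block; this lowers the range
  -- from m + 1 to the m actual adjacent pairs.
  · rw [length_eq_card_inversions, card_inversions_eq_pairCount hσ, hw.pairCount_inversions,
      pairCount_succ_of_forall_not, pairCount_succ_of_forall_not, pairCount_succ_of_forall_not]
    · exact fun i _ h => hlast _ h.2.1
    · exact fun i _ h => hlast _ h.2.2
    · exact fun i _ h => hlast _ h.1
  · rw [depth_eq_sum_descents hσ, hw.sum_descent_sizes, pairCount_succ_of_forall_not]
    exact fun i _ h => hlast _ h.1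

end Cycle

end PermStat

theorem mainTheorem10 (n : ℕ) (hn : 1 ≤ n) (σ : Equiv.Perm (Fin n))
    (hσ : σ.IsCycleOn Set.univ) :
    (PermStat.length σ : ℚ) = (n : ℚ) - 1 + 2 *
        ((PermStat.patternCount PermStat.pat2_31 (PermStat.fundamental σ) : ℚ)
          + (PermStat.patternCount PermStat.pat14_23 (PermStat.fundamental σ) : ℚ)
          + (PermStat.patternCount PermStat.pat41_32 (PermStat.fundamental σ) : ℚ)) ∧
    (PermStat.depth σ : ℚ) = (n : ℚ) - 1 +
        ((PermStat.patternCount PermStat.pat2_31 (PermStat.fundamental σ) : ℚ)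
          + (PermStat.patternCount PermStat.pat14_23 (PermStat.fundamental σ) : ℚ)
          + (PermStat.patternCount PermStat.pat41_32 (PermStat.fundamental σ) : ℚ)
          + (PermStat.patternCount PermStat.pat24_13 (PermStat.fundamental σ) : ℚ)
          + (PermStat.patternCount PermStat.pat31_42 (PermStat.fundamental σ) : ℚ)) ∧
    (PermStat.depth σ : ℚ) =
        ((PermStat.length σ : ℚ) + (PermStat.reflectionLength σ : ℚ)) / 2 +
        ((PermStat.patternCount PermStat.pat31_42 (PermStat.fundamental σ) : ℚ)
          + (PermStat.patternCount PermStat.pat24_13 (PermStat.fundamental σ) : ℚ)) ∧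
    (PermStat.IsShallow σ ↔
      PermStat.Avoids (PermStat.fundamental σ) PermStat.pat31_42 ∧
      PermStat.Avoids (PermStat.fundamental σ) PermStat.pat24_13) := by
  obtain ⟨m, rfl⟩ : ∃ m, n = m + 1 := ⟨n - 1, by omega⟩
  obtain ⟨hl, hd⟩ := PermStat.length_and_depth_of_isCycleOn_univ hσ
  have hl' : (PermStat.length σ : ℚ) = m + 2 *
      ((PermStat.patternCount PermStat.pat2_31 (PermStat.fundamental σ) : ℚ)
        + (PermStat.patternCount PermStat.pat14_23 (PermStat.fundamental σ) : ℚ)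
        + (PermStat.patternCount PermStat.pat41_32 (PermStat.fundamental σ) : ℚ)) := by
    exact_mod_cast hl
  have hd' : (PermStat.depth σ : ℚ) = m +
      ((PermStat.patternCount PermStat.pat2_31 (PermStat.fundamental σ) : ℚ)
        + (PermStat.patternCount PermStat.pat14_23 (PermStat.fundamental σ) : ℚ)
        + (PermStat.patternCount PermStat.pat41_32 (PermStat.fundamental σ) : ℚ)
        + (PermStat.patternCount PermStat.pat24_13 (PermStat.fundamental σ) : ℚ)
        + (PermStat.patternCount PermStat.pat31_42 (PermStat.fundamental σ) : ℚ)) := by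
    exact_mod_cast hd
  have hdl : (PermStat.depth σ : ℚ) =
      ((PermStat.length σ : ℚ) + (PermStat.reflectionLength σ : ℚ)) / 2 +
      ((PermStat.patternCount PermStat.pat31_42 (PermStat.fundamental σ) : ℚ)
        + (PermStat.patternCount PermStat.pat24_13 (PermStat.fundamental σ) : ℚ)) := by
    rw [hl', hd', PermStat.reflectionLength_of_isCycleOn_univ hσ]
    ring
  refine ⟨?_, ?_, hdl, ?_⟩
  · rw [hl']
    push_cast
    ring
  · rw [hd']
    push_cast
    ring
  -- The excess of the depth is a sum of two natural numbers, zero exactly when both are.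
  · rw [PermStat.IsShallow, hdl, add_eq_left, PermStat.avoids_iff_patternCount_eq_zero,
      PermStat.avoids_iff_patternCount_eq_zero]
    norm_cast
    omega
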